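/- Lemma 4.4 (Reduced Version of Functional Inequality). Let $G(x)=\pi^{-3/2}e^{-|x|^2}$ on $\mathbb R^3$ and, for $\eta<\tfrac13$, let $G_N(x)=N^{3\eta}G(N^{\eta}x)$. For $\psi\in L^2(\mathbb R^{3N})$ and $k\le N$ put $$\rho^{(k)}(X_k)=\gamma^{(k)}(X_k,X_k),\qquad \gamma^{(k)}(X_k,X_k')=\int \psi(X_k,X_{N-k})\,\overline{\psi(X_k',X_{N-k})}\,dX_{N-k}.$$ For every $\eta<\tfrac13$ and all $M,K,L\ge 0$ there is a constant $C\ge 0$ (depending only on $\eta,M,K,L$, not on $N,\hbar$) such that the following holds. Let $N\ge 2$, $0<\hbar\le 1$; let $\psi=\psi_{N,\hbar}\in L^2(\mathbb R^{3N})$ be a normalized bosonic (permutation symmetric) $N$-particle wave function; let $\rho\ge 0$ be a probability density on $\mathbb R^3$ with $\rho\le M$ almost everywhere; and let $F:\mathbb R^3\to\mathbb R$ satisfy $|F|\le K$ and be Lipschitz with constant $L$. Then, with $$\Phi(x,y)=\frac{N-1}{N}\rho^{(2)}(x,y)-\rho^{(1)}(x)\rho(y)-\rho(x)\rho^{(1)}(y)+\rho(x)\rho(y),$$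 the functions $F(x)G_N(x-y)\Phi(x,y)$ and $G_N(x-y)\Phi(x,y)$ are integrable on $\mathbb R^3\times\mathbb R^3$ and $$\int F(x)G_N(x-y)\Phi(x,y)\,dx\,dy\;\le\;\|F\|_{L^\infty}\int G_N(x-y)\Phi(x,y)\,dx\,dy\;+\;C\left(N^{-\eta}\hbar^{-2}+N^{3\eta-1}\right).$$ In particular this applies, uniformly in time, to $\psi=\psi_{N,\hbar}(t)$, a solution of the bosonic $N$-body Schrödinger equation, and $\rho=\rho(t,\cdot)$, a density bounded uniformly in $t\in[0,T_0]$. -/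

import Mathlib

open MeasureTheory
open scoped NNReal

namespace QuantumNBody

noncomputable section

/-- The physical space `ℝ³` with its Euclidean norm and Lebesgue measure. -/
abbrev Space : Type := EuclideanSpace ℝ (Fin 3)

/-- A configuration `X_k = (x₁, …, x_k)` of `k` particles, i.e. a point of `ℝ^{3k}`
(with the product Lebesgue measure). -/
abbrev Config (k : ℕ) : Type := Fin k → Space

/-- The configuration `(X_k, X_{N-k})` of `N` particles: the first `k` particles are at `X`, the
remaining `N - k` particles at `Y`. -/
def joinConfig {N k : ℕ} (hk : k ≤ N) (X : Config k) (Y : Config (N - k)) : Config N :=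
  fun i => Fin.append X Y (Fin.cast (Nat.add_sub_of_le hk).symm i)

/-- Normalized bosonic `N`-particle wave functions: `ψ ∈ L²(ℝ^{3N})`, `‖ψ‖_{L²} = 1`, and `ψ` is
symmetric under permutations of the particles (as an element of `L²`, i.e. almost everywhere). -/
structure IsBosonicState {N : ℕ} (ψ : Config N → ℂ) : Prop where
  memLp : MemLp ψ 2 volume
  normalized : ∫ X, ‖ψ X‖ ^ 2 = 1
  symmetric : ∀ σ : Equiv.Perm (Fin N), ∀ᵐ X : Config N, ψ (fun i => X (σ i)) = ψ X

/-- The kernel of the `k`-particle marginal density of `ψ`,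
`γ^{(k)}(X_k, X_k') = ∫ ψ(X_k, X_{N-k}) conj(ψ(X_k', X_{N-k})) dX_{N-k}`. -/
def marginalKernel {N k : ℕ} (hk : k ≤ N) (ψ : Config N → ℂ) (X X' : Config k) : ℂ :=
  ∫ Y : Config (N - k),
    ψ (joinConfig hk X Y) * (starRingEnd ℂ) (ψ (joinConfig hk X' Y))

/-- The quantum mass density `ρ^{(k)}(X_k) = γ^{(k)}(X_k, X_k)`
(this diagonal value is real, being an integral of `|ψ|²`). -/
def massDensity {N k : ℕ} (hk : k ≤ N) (ψ : Config N → ℂ) (X : Config k) : ℝ :=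
  (marginalKernel hk ψ X X).re

/-- The standard Gaussian `G(x) = (1/π)^{3/2} e^{-|x|²}` on `ℝ³`. -/
def gaussian (x : Space) : ℝ :=
  (1 / Real.pi) ^ (3 / 2 : ℝ) * Real.exp (-‖x‖ ^ 2)

/-- The rescaled Gaussian `G_N(x) = N^{3η} G(N^η x)`. -/
def scaledGaussian (η : ℝ) (N : ℕ) (x : Space) : ℝ :=
  (N : ℝ) ^ (3 * η) * gaussian ((N : ℝ) ^ η • x)

/-- The two-body fluctuation
`(N-1)/N ρ^{(2)}(x,y) - ρ^{(1)}(x) ρ(y) - ρ(x) ρ^{(1)}(y) + ρ(x) ρ(y)`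
of the `N`-particle state `ψ` around the one-particle density `ρ`. -/
def twoBodyFluctuation {N : ℕ} (hN : 2 ≤ N) (ψ : Config N → ℂ) (ρ : Space → ℝ)
    (x y : Space) : ℝ :=
  ((N : ℝ) - 1) / N * massDensity hN ψ ![x, y]
    - massDensity (one_le_two.trans hN) ψ ![x] * ρ y
    - ρ x * massDensity (one_le_two.trans hN) ψ ![y]
    + ρ x * ρ y

/-- `ρ` is a probability density on `ℝ³` that is bounded by `M`. -/
structure IsBoundedDensity (M : ℝ) (ρ : Space → ℝ) : Prop where
  integrable : Integrable ρ
  nonneg : ∀ᵐ x, 0 ≤ ρ x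
  le_bound : ∀ᵐ x, ρ x ≤ M
  mass_one : ∫ x, ρ x = 1

end

end QuantumNBody

open QuantumNBody

/-! ### Marginal densities as expectations under `|ψ|²` -/

namespace QuantumNBody

/-! Put `W = sup |F| - F ≥ 0`; the claim is a lower bound for the integral of `W(x) G_N(x-y)
Φ(x,y)`. Under the probability density `|ψ|²`, `Φ` is the mean of `(μ_X - ρ) ⊗ (μ_X - ρ)`, with
`μ_X` the empirical measure of the particles, minus its diagonal part. Removing the diagonal costs
at most `sup W * G_N(0) / N`, of order `N^(3η-1)`.

A Gaussian is a convolution square, so `√W(x) √W(y) G_N(x-y)` is positive definite and has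
nonnegative energy on `μ_X - ρ`. By symmetry of `Φ`, `W(x)` may be replaced by `(W(x) + W(y)) / 2`,
which exceeds `√W(x) √W(y)` by `(√W(x) - √W(y))² / 2 ≤ L |x-y| / 2`. This excess is nonnegative, so
it hurts only in the cross term `μ_X ⊗ ρ`, where `ρ ≤ M` and the first moment of `G_N` make it
`O(N^(-η))`; singular pairs of particles never need control.

The core is `IsConvSquare.weighted_energy_lower_bound`;
`IsConvSquare.weighted_fluctuation_lower_bound` averages it over `|ψ|²`, and `isConvSquare_gaussian`
supplies the profile. -/

theorem measurePreserving_joinConfig {N k : ℕ} (hk : k ≤ N) :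
    ∃ e : (Config k × Config (N - k)) ≃ᵐ Config N,
      MeasurePreserving e ∧ ∀ p, e p = joinConfig hk p.1 p.2 := by
  let e₁ := (MeasurableEquiv.sumPiEquivProdPi (fun _ : Fin k ⊕ Fin (N - k) => Space)).symm
  let f : Fin k ⊕ Fin (N - k) ≃ Fin N :=
    finSumFinEquiv.trans (finCongr (Nat.add_sub_of_le hk))
  let e₂ := MeasurableEquiv.piCongrLeft (fun _ : Fin N => Space) f
  have h₁ : MeasurePreserving e₁ :=
    volume_measurePreserving_sumPiEquivProdPi_symm (fun _ : Fin k ⊕ Fin (N - k) => Space)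
  have h₂ : MeasurePreserving e₂ :=
    volume_measurePreserving_piCongrLeft (fun _ : Fin N => Space) f
  refine ⟨e₁.trans e₂, h₁.trans h₂, fun p => ?_⟩
  funext i
  obtain ⟨j, rfl⟩ := f.surjective i
  change e₂ (e₁ p) (f j) = _
  rw [MeasurableEquiv.piCongrLeft_apply_apply]
  rcases j with a | b
  · simp [joinConfig, f, e₁, MeasurableEquiv.coe_sumPiEquivProdPi_symm]
  · simp [joinConfig, f, e₁, MeasurableEquiv.coe_sumPiEquivProdPi_symm]

theorem joinConfig_castLE {N k : ℕ} (hk : k ≤ N) (X : Config k) (Y : Config (N - k)) :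
    (fun i => joinConfig hk X Y (Fin.castLE hk i)) = X := by
  funext i
  have : Fin.cast (Nat.add_sub_of_le hk).symm (Fin.castLE hk i) = Fin.castAdd (N - k) i := by
    ext; simp
  rw [joinConfig, this, Fin.append_left]

theorem massDensity_eq_integral {N k : ℕ} (hk : k ≤ N) (ψ : Config N → ℂ) (X : Config k) :
    massDensity hk ψ X = ∫ Y, ‖ψ (joinConfig hk X Y)‖ ^ 2 := by
  have : marginalKernel hk ψ X X = ∫ Y, ((‖ψ (joinConfig hk X Y)‖ ^ 2 : ℝ) : ℂ) := by
    refine integral_congr_ae (.of_forall fun Y => ?_)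
    simp [Complex.mul_conj']
  rw [massDensity, this, integral_complex_ofReal, Complex.ofReal_re]

theorem IsBosonicState.integrable_sq {N : ℕ} {ψ : Config N → ℂ} (hψ : IsBosonicState ψ) :
    Integrable (fun X => ‖ψ X‖ ^ 2) :=
  (memLp_two_iff_integrable_sq_norm hψ.memLp.1).1 hψ.memLp

theorem integrable_massDensity {N k : ℕ} (hk : k ≤ N) {ψ : Config N → ℂ}
    (hψ : Integrable (fun X => ‖ψ X‖ ^ 2)) : Integrable (massDensity hk ψ) := by
  obtain ⟨e, he, hje⟩ := measurePreserving_joinConfig hk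
  have h := (he.integrable_comp_emb e.measurableEmbedding).2 hψ
  refine h.integral_prod_left.congr (.of_forall fun X => ?_)
  simp [massDensity_eq_integral, hje]

/-- Fubini along the splitting of `Config N`; boundedness of `f` supplies the integrability. -/
theorem integral_mul_massDensity {N k : ℕ} (hk : k ≤ N) {ψ : Config N → ℂ}
    (hψ : Integrable (fun X => ‖ψ X‖ ^ 2)) {f : Config k → ℝ} (hf : Measurable f) {B : ℝ}
    (hB : ∀ X, |f X| ≤ B) :
    ∫ X, f X * massDensity hk ψ X = ∫ X, f (fun i => X (Fin.castLE hk i)) * ‖ψ X‖ ^ 2 := by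
  obtain ⟨e, he, hje⟩ := measurePreserving_joinConfig hk
  have h := (he.integrable_comp_emb e.measurableEmbedding).2 hψ
  have h' : Integrable (fun p : Config k × Config (N - k) => f p.1 * ‖ψ (e p)‖ ^ 2) :=
    h.bdd_mul (hf.comp measurable_fst).aestronglyMeasurable (.of_forall fun p => hB p.1)
  rw [← he.integral_comp e.measurableEmbedding]
  simp only [hje, joinConfig_castLE] at h' ⊢
  have := integral_prod _ h'
  rw [← Measure.volume_eq_prod] at this
  rw [this]
  refine integral_congr_ae (.of_forall fun X => ?_)
  simp only [massDensity_eq_integral]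
  rw [integral_const_mul]

theorem measurePreserving_vecSingle :
    MeasurePreserving (MeasurableEquiv.funUnique (Fin 1) Space).symm :=
  (volume_preserving_funUnique (Fin 1) Space).symm

theorem integrable_massDensity_one {N : ℕ} (hk : 1 ≤ N) {ψ : Config N → ℂ}
    (hψ : Integrable (fun X => ‖ψ X‖ ^ 2)) :
    Integrable (fun x : Space => massDensity hk ψ ![x]) := by
  have h := (measurePreserving_vecSingle.integrable_comp_emb
    (MeasurableEquiv.measurableEmbedding _)).2 (integrable_massDensity hk hψ)
  refine h.congr (.of_forall fun x => ?_)
  simp only [Function.comp]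
  congr 1
  funext i
  fin_cases i
  rfl

theorem integral_mul_massDensity_one {N : ℕ} (hk : 1 ≤ N) {ψ : Config N → ℂ}
    (hψ : Integrable (fun X => ‖ψ X‖ ^ 2)) {f : Space → ℝ} (hf : Measurable f) {B : ℝ}
    (hB : ∀ x, |f x| ≤ B) :
    ∫ x, f x * massDensity hk ψ ![x] = ∫ X, f (X (Fin.castLE hk 0)) * ‖ψ X‖ ^ 2 := by
  rw [← integral_mul_massDensity hk hψ (f := fun X => f (X 0))
    (hf.comp (measurable_pi_apply 0)) (fun X => hB _),
    ← measurePreserving_vecSingle.integral_comp (MeasurableEquiv.measurableEmbedding _)]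
  refine integral_congr_ae (.of_forall fun x => ?_)
  have : (![x] : Config 1) = (MeasurableEquiv.funUnique (Fin 1) Space).symm x := by
    funext i
    fin_cases i
    rfl
  simp only [this]
  rfl

theorem measurePreserving_vecPair :
    MeasurePreserving (MeasurableEquiv.finTwoArrow (α := Space)).symm :=
  (volume_preserving_finTwoArrow Space).symm

theorem finTwoArrow_symm_eq (p : Space × Space) :
    (MeasurableEquiv.finTwoArrow (α := Space)).symm p = ![p.1, p.2] := by
  funext i
  fin_cases i <;> rfl

theorem integrable_massDensity_two {N : ℕ} (hk : 2 ≤ N) {ψ : Config N → ℂ}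
    (hψ : Integrable (fun X => ‖ψ X‖ ^ 2)) :
    Integrable (fun p : Space × Space => massDensity hk ψ ![p.1, p.2]) := by
  have h := (measurePreserving_vecPair.integrable_comp_emb
    (MeasurableEquiv.measurableEmbedding _)).2 (integrable_massDensity hk hψ)
  refine h.congr (.of_forall fun p => ?_)
  simp only [Function.comp, finTwoArrow_symm_eq]

theorem integral_mul_massDensity_two {N : ℕ} (hk : 2 ≤ N) {ψ : Config N → ℂ}
    (hψ : Integrable (fun X => ‖ψ X‖ ^ 2)) {f : Space × Space → ℝ} (hf : Measurable f) {B : ℝ}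
    (hB : ∀ x, |f x| ≤ B) :
    ∫ p : Space × Space, f p * massDensity hk ψ ![p.1, p.2] =
      ∫ X, f (X (Fin.castLE hk 0), X (Fin.castLE hk 1)) * ‖ψ X‖ ^ 2 := by
  rw [← integral_mul_massDensity hk hψ (f := fun X => f (X 0, X 1))
    (hf.comp (by fun_prop)) (fun X => hB _),
    ← measurePreserving_vecPair.integral_comp (MeasurableEquiv.measurableEmbedding _)]
  simp only [finTwoArrow_symm_eq, Matrix.cons_val_zero, Matrix.cons_val_one]

theorem IsBosonicState.integral_comp_perm {N : ℕ} {ψ : Config N → ℂ} (hψ : IsBosonicState ψ)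
    (σ : Equiv.Perm (Fin N)) (f : Config N → ℝ) :
    ∫ X, f (fun i => X (σ i)) * ‖ψ X‖ ^ 2 = ∫ X, f X * ‖ψ X‖ ^ 2 := by
  let e := MeasurableEquiv.piCongrLeft (fun _ : Fin N => Space) σ.symm
  have he : MeasurePreserving e :=
    volume_measurePreserving_piCongrLeft (fun _ : Fin N => Space) σ.symm
  have heq : ∀ X, e X = fun i => X (σ i) := fun X => by
    funext i
    have := MeasurableEquiv.piCongrLeft_apply_apply σ.symm (β := fun _ => Space) X (σ i)
    simpa using this
  rw [← he.integral_comp e.measurableEmbedding (fun X => f X * ‖ψ X‖ ^ 2)]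
  refine integral_congr_ae ?_
  filter_upwards [hψ.symmetric σ] with X hX
  simp only [heq, hX]

/-! ### Energies of positive definite kernels -/

section Kernel

variable {α β : Type*} [MeasurableSpace α] [MeasurableSpace β]

/-- `τ` may be infinite, so boundedness alone is not enough: one factor is bounded, the other is
`L¹` in `z` uniformly in its first variable. -/
theorem integrable_kernel_mul_kernel (μ ν : Measure α) [IsFiniteMeasure μ] [IsFiniteMeasure ν]
    (τ : Measure β) [SFinite τ] {k : α × β → ℝ} (hk : Measurable k) {B B' : ℝ}
    (hB : ∀ p, |k p| ≤ B) (hki : ∀ x, Integrable (fun z => k (x, z)) τ)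
    (hB' : ∀ x, ∫ z, |k (x, z)| ∂τ ≤ B') :
    Integrable (fun q : (α × α) × β => k (q.1.1, q.2) * k (q.1.2, q.2)) ((μ.prod ν).prod τ) := by
  have hm : Measurable (fun q : (α × α) × β => k (q.1.2, q.2)) := hk.comp (by fun_prop)
  have hm' : Measurable (fun q : (α × α) × β => k (q.1.1, q.2)) := hk.comp (by fun_prop)
  refine Integrable.bdd_mul (c := B) ?_ hm'.aestronglyMeasurable (.of_forall fun q => hB _)
  rw [integrable_prod_iff hm.aestronglyMeasurable]
  refine ⟨.of_forall fun p => hki p.2, ?_⟩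
  refine Integrable.of_bound (C := B') hm.norm.aestronglyMeasurable.integral_prod_right'
    (.of_forall fun p => ?_)
  rw [Real.norm_of_nonneg (by positivity)]
  exact hB' p.2

theorem integral_prod_kernel (μ ν : Measure α) [IsFiniteMeasure μ] [IsFiniteMeasure ν]
    (τ : Measure β) [SFinite τ] {k : α × β → ℝ} (hk : Measurable k) {B B' : ℝ}
    (hB : ∀ p, |k p| ≤ B) (hki : ∀ x, Integrable (fun z => k (x, z)) τ)
    (hB' : ∀ x, ∫ z, |k (x, z)| ∂τ ≤ B') :
    Integrable (fun z => (∫ x, k (x, z) ∂μ) * ∫ y, k (y, z) ∂ν) τ ∧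
    ∫ p : α × α, (∫ z, k (p.1, z) * k (p.2, z) ∂τ) ∂(μ.prod ν) =
      ∫ z, (∫ x, k (x, z) ∂μ) * (∫ y, k (y, z) ∂ν) ∂τ := by
  have h := integrable_kernel_mul_kernel μ ν τ hk hB hki hB'
  have e : ∀ z, ∫ p : α × α, k (p.1, z) * k (p.2, z) ∂(μ.prod ν) =
      (∫ x, k (x, z) ∂μ) * ∫ y, k (y, z) ∂ν := fun z =>
    integral_prod_mul (fun x => k (x, z)) (fun y => k (y, z))
  constructor
  · simpa only [e] using h.integral_prod_right
  · have := integral_integral_swap (f := fun (p : α × α) (z : β) => k (p.1, z) * k (p.2, z)) h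
    rw [this]
    simp only [e]

/-- By Fubini the expression is the `τ`-integral of the square of the potential of `μ - cν`.
Expanding it by hand avoids signed measures. -/
theorem kernel_energy_nonneg (μ ν : Measure α) [IsFiniteMeasure μ] [IsFiniteMeasure ν]
    (τ : Measure β) [SFinite τ] {k : α × β → ℝ} (hk : Measurable k) {B B' : ℝ}
    (hB : ∀ p, |k p| ≤ B) (hki : ∀ x, Integrable (fun z => k (x, z)) τ)
    (hB' : ∀ x, ∫ z, |k (x, z)| ∂τ ≤ B') (c : ℝ) {A : α × α → ℝ}
    (hA : ∀ p, A p = ∫ z, k (p.1, z) * k (p.2, z) ∂τ) :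
    0 ≤ ∫ p, A p ∂(μ.prod μ) - 2 * c * ∫ p, A p ∂(μ.prod ν) + c ^ 2 * ∫ p, A p ∂(ν.prod ν) := by
  obtain ⟨i₁, e₁⟩ := integral_prod_kernel μ μ τ hk hB hki hB'
  obtain ⟨i₂, e₂⟩ := integral_prod_kernel μ ν τ hk hB hki hB'
  obtain ⟨i₃, e₃⟩ := integral_prod_kernel ν ν τ hk hB hki hB'
  simp only [hA]
  have h : 0 ≤ ∫ z, ((∫ x, k (x, z) ∂μ) - c * ∫ x, k (x, z) ∂ν) ^ 2 ∂τ :=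
    integral_nonneg fun z => sq_nonneg _
  have hexp : ∀ z, ((∫ x, k (x, z) ∂μ) - c * ∫ x, k (x, z) ∂ν) ^ 2 =
      (∫ x, k (x, z) ∂μ) * (∫ x, k (x, z) ∂μ) -
      2 * c * ((∫ x, k (x, z) ∂μ) * ∫ x, k (x, z) ∂ν) +
      c ^ 2 * ((∫ x, k (x, z) ∂ν) * ∫ x, k (x, z) ∂ν) := fun z => by ring
  simp only [hexp] at h
  rwa [integral_add (i₁.sub' (i₂.const_mul _)) (i₃.const_mul _),
    integral_sub i₁ (i₂.const_mul _), integral_const_mul, integral_const_mul,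
    ← e₁, ← e₂, ← e₃] at h

end Kernel

/-! ### Weighted energies of convolution squares -/

/-- Lets a Lipschitz bound on `W` suffice, although `√W` need not be Lipschitz near zeros of `W`. -/
theorem sq_sqrt_sub_sqrt_le_abs_sub {a b : ℝ} (ha : 0 ≤ a) (hb : 0 ≤ b) :
    (√a - √b) ^ 2 ≤ |a - b| := by
  have h : a - b = (√a - √b) * (√a + √b) := by
    nlinarith [Real.sq_sqrt ha, Real.sq_sqrt hb]
  rw [h, abs_mul, ← sq_abs, sq]
  refine mul_le_mul_of_nonneg_left ?_ (abs_nonneg _)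
  rw [abs_of_nonneg (by positivity : 0 ≤ √a + √b), abs_le]
  constructor <;> nlinarith [Real.sqrt_nonneg a, Real.sqrt_nonneg b]

theorem integrable_of_measurable_of_bdd {α : Type*} [MeasurableSpace α] {μ : Measure α}
    [IsFiniteMeasure μ] {f : α → ℝ} (hf : Measurable f) {B : ℝ} (hB : ∀ x, |f x| ≤ B) :
    Integrable f μ :=
  Integrable.of_bound hf.aestronglyMeasurable B (.of_forall hB)

/-- An interaction profile that is a convolution square, hence positive definite. -/
structure IsConvSquare (g : Space → ℝ) : Prop where
  continuous : Continuous g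
  nonneg : ∀ x, 0 ≤ g x
  bdd : ∃ B, ∀ x, g x ≤ B
  bdd_moment : ∃ B, ∀ x, ‖x‖ * g x ≤ B
  factor : ∃ h : Space → ℝ, Continuous h ∧ Integrable h ∧ (∃ B, ∀ x, |h x| ≤ B) ∧
    ∀ x y, g (x - y) = ∫ z, h (x - z) * h (y - z)

/-- The interaction `g (x - y)` weighted by the mean of `W x` and `W y`. -/
noncomputable def weightedKernel (W g : Space → ℝ) (p : Space × Space) : ℝ :=
  (W p.1 + W p.2) / 2 * g (p.1 - p.2)

theorem measurable_weightedKernel {W g : Space → ℝ} (hW : Measurable W) (hg : Measurable g) :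
    Measurable (weightedKernel W g) := by
  unfold weightedKernel
  fun_prop

theorem IsConvSquare.exists_weightedKernel_bdd {W g : Space → ℝ} (hg : IsConvSquare g) {b : ℝ}
    (hW0 : ∀ x, 0 ≤ W x) (hWb : ∀ x, W x ≤ b) : ∃ B, ∀ p, |weightedKernel W g p| ≤ B := by
  obtain ⟨B, hB⟩ := hg.bdd
  refine ⟨b * B, fun p => ?_⟩
  have h1 := hW0 p.1
  have h2 := hW0 p.2
  have h3 := hWb p.1
  have h4 := hWb p.2
  have h5 := hg.nonneg (p.1 - p.2)
  rw [weightedKernel, abs_of_nonneg (by positivity)]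
  exact mul_le_mul (by linarith) (hB _) h5 (by linarith)

/-- The arithmetic-mean weight is compared with the geometric-mean weight, whose energy is a square.
The error involves only `μ.prod ν`, so `μ` may have atoms. -/
theorem IsConvSquare.weighted_energy_lower_bound {g : Space → ℝ} (hg : IsConvSquare g)
    {W : Space → ℝ} {L : ℝ≥0} (hWL : LipschitzWith L W) {b : ℝ}
    (hW0 : ∀ x, 0 ≤ W x) (hWb : ∀ x, W x ≤ b) (μ ν : Measure Space)
    [IsFiniteMeasure μ] [IsFiniteMeasure ν] {c : ℝ} (hc : 0 ≤ c) :
    -(c * (L * ∫ p : Space × Space, ‖p.1 - p.2‖ * g (p.1 - p.2) ∂(μ.prod ν))) ≤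
      ∫ p, weightedKernel W g p ∂(μ.prod μ) - 2 * c * ∫ p, weightedKernel W g p ∂(μ.prod ν) +
        c ^ 2 * ∫ p, weightedKernel W g p ∂(ν.prod ν) := by
  obtain ⟨h, hhc, hhi, ⟨Bh, hBh⟩, hfac⟩ := hg.factor
  obtain ⟨Bm, hBm⟩ := hg.bdd_moment
  obtain ⟨Bg, hBg⟩ := hg.bdd
  have hWm : Measurable W := hWL.continuous.measurable
  have hgm : Measurable g := hg.continuous.measurable
  have hsb : ∀ x, √(W x) ≤ √b := fun x => Real.sqrt_le_sqrt (hWb x)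
  let k : Space × Space → ℝ := fun p => √(W p.1) * h (p.1 - p.2)
  have hkm : Measurable k := by
    have := hhc.measurable
    fun_prop
  have hkB : ∀ p, |k p| ≤ √b * Bh := fun p => by
    rw [abs_mul, abs_of_nonneg (Real.sqrt_nonneg _)]
    exact mul_le_mul (hsb _) (hBh _) (abs_nonneg _) (Real.sqrt_nonneg _)
  have hki : ∀ x, Integrable (fun z => k (x, z)) := fun x =>
    (hhi.comp_sub_left x).const_mul √(W x)
  have hkB' : ∀ x, ∫ z, |k (x, z)| ≤ √b * ∫ z, |h z| := fun x => by
    simp only [k, abs_mul, abs_of_nonneg (Real.sqrt_nonneg _)]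
    rw [integral_const_mul, integral_sub_left_eq_self (fun z => |h z|) volume x]
    exact mul_le_mul_of_nonneg_right (hsb x) (integral_nonneg fun _ => abs_nonneg _)
  let A : Space × Space → ℝ := fun p => √(W p.1) * √(W p.2) * g (p.1 - p.2)
  have hA : ∀ p, A p = ∫ z, k (p.1, z) * k (p.2, z) := fun p => by
    simp only [A, k, hfac]
    rw [← integral_const_mul]
    refine integral_congr_ae (.of_forall fun z => ?_)
    ring
  have hAm : Measurable A := by fun_prop
  have hA0 : ∀ p, 0 ≤ A p := fun p => by
    have := hg.nonneg (p.1 - p.2)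
    positivity
  have hAB : ∀ p, |A p| ≤ √b * √b * Bg := fun p => by
    rw [abs_of_nonneg (hA0 p)]
    exact mul_le_mul (mul_le_mul (hsb _) (hsb _) (Real.sqrt_nonneg _) (Real.sqrt_nonneg _))
      (hBg _) (hg.nonneg _) (by positivity)
  have hE := kernel_energy_nonneg μ ν volume hkm hkB hki hkB' c hA
  obtain ⟨BS, hBS⟩ := hg.exists_weightedKernel_bdd hW0 hWb
  have hSm := measurable_weightedKernel hWm hgm
  let D : Space × Space → ℝ := fun p => ‖p.1 - p.2‖ * g (p.1 - p.2)
  have hDm : Measurable D := by fun_prop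
  have hD0 : ∀ p, 0 ≤ D p := fun p => mul_nonneg (norm_nonneg _) (hg.nonneg _)
  have hDB : ∀ p, |D p| ≤ Bm := fun p => by
    rw [abs_of_nonneg (hD0 p)]
    exact hBm _
  have hsplit : ∀ p, weightedKernel W g p =
      A p + (√(W p.1) - √(W p.2)) ^ 2 / 2 * g (p.1 - p.2) := fun p => by
    simp only [weightedKernel, A]
    rw [sub_sq, Real.sq_sqrt (hW0 _), Real.sq_sqrt (hW0 _)]
    ring
  have hle : ∀ p, A p ≤ weightedKernel W g p := fun p => by
    rw [hsplit]
    have := hg.nonneg (p.1 - p.2)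
    have : 0 ≤ (√(W p.1) - √(W p.2)) ^ 2 / 2 * g (p.1 - p.2) := by positivity
    linarith
  have hge : ∀ p, 2 * weightedKernel W g p ≤ 2 * A p + L * D p := fun p => by
    rw [hsplit]
    have h1 := sq_sqrt_sub_sqrt_le_abs_sub (hW0 p.1) (hW0 p.2)
    have h2 : |W p.1 - W p.2| ≤ L * ‖p.1 - p.2‖ := by
      simpa [Real.dist_eq, dist_eq_norm] using hWL.dist_le_mul p.1 p.2
    have h3 := mul_le_mul_of_nonneg_right (h1.trans h2) (hg.nonneg (p.1 - p.2))
    simp only [D]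
    linarith
  have hi := fun (κ : Measure (Space × Space)) [IsFiniteMeasure κ] =>
    integrable_of_measurable_of_bdd (μ := κ) hAm hAB
  have hiS := fun (κ : Measure (Space × Space)) [IsFiniteMeasure κ] =>
    integrable_of_measurable_of_bdd (μ := κ) hSm hBS
  have hiD := fun (κ : Measure (Space × Space)) [IsFiniteMeasure κ] =>
    integrable_of_measurable_of_bdd (μ := κ) hDm hDB
  -- The terms with positive coefficient use only `A ≤ weightedKernel`; the Lipschitz error is paid
  -- solely in the term with coefficient `-2c`.
  have m₁ := integral_mono (hi (μ.prod μ)) (hiS (μ.prod μ)) hle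
  have m₃ := integral_mono (hi (ν.prod ν)) (hiS (ν.prod ν)) hle
  have m₂ := integral_mono ((hiS (μ.prod ν)).const_mul 2)
    (((hi (μ.prod ν)).const_mul 2).add ((hiD (μ.prod ν)).const_mul L)) hge
  simp only [Pi.add_apply] at m₂
  rw [integral_add ((hi _).const_mul 2) ((hiD _).const_mul L), integral_const_mul,
    integral_const_mul, integral_const_mul] at m₂
  have m₂' := mul_le_mul_of_nonneg_left m₂ hc
  have m₃' := mul_le_mul_of_nonneg_left m₃ (sq_nonneg c)
  simp only [D] at m₂'
  linarith

/-- The weighted energy bound for the empirical measure of finitely many points. -/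
theorem IsConvSquare.empirical_energy_lower_bound {g : Space → ℝ} (hg : IsConvSquare g)
    {W : Space → ℝ} {L : ℝ≥0} (hWL : LipschitzWith L W) {b : ℝ}
    (hW0 : ∀ x, 0 ≤ W x) (hWb : ∀ x, W x ≤ b) (ν : Measure Space) [IsFiniteMeasure ν]
    {N : ℕ} (X : Config N) {m : ℝ} (hm : ∀ x, ∫ y, ‖x - y‖ * g (x - y) ∂ν ≤ m) :
    -(L * m * N ^ 2) ≤
      (∑ i, ∑ j, weightedKernel W g (X i, X j)) -
        2 * N * ∑ i, ∫ y, weightedKernel W g (X i, y) ∂ν +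
        N ^ 2 * ∫ p, weightedKernel W g p ∂(ν.prod ν) := by
  -- Unnormalized, of mass `N`; hence `c = N` below.
  let μ : Measure Space := ∑ i, Measure.dirac (X i)
  have hμ : ∀ f : Space → ℝ, ∫ x, f x ∂μ = ∑ i, f (X i) := fun f => by
    rw [integral_finsetSum_measure fun i _ => integrable_dirac (by simp)]
    simp
  have hWm : Measurable W := hWL.continuous.measurable
  have hgm : Measurable g := hg.continuous.measurable
  obtain ⟨BS, hBS⟩ := hg.exists_weightedKernel_bdd hW0 hWb
  obtain ⟨Bm, hBm⟩ := hg.bdd_moment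
  have hSm := measurable_weightedKernel hWm hgm
  have key := hg.weighted_energy_lower_bound hWL hW0 hWb μ ν (c := N) (by positivity)
  rw [integral_prod _ (integrable_of_measurable_of_bdd (μ := μ.prod μ) hSm hBS),
    integral_prod _ (integrable_of_measurable_of_bdd (μ := μ.prod ν) hSm hBS),
    integral_prod _ (integrable_of_measurable_of_bdd (μ := μ.prod ν) (B := Bm) (by fun_prop)
      fun p => by
        rw [abs_of_nonneg (mul_nonneg (norm_nonneg _) (hg.nonneg _))]
        exact hBm _)] at key
  simp only [hμ] at key
  refine le_trans ?_ key
  have : ∑ i, ∫ y, ‖X i - y‖ * g (X i - y) ∂ν ≤ N * m := by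
    refine (Finset.sum_le_sum fun i _ => hm (X i)).trans ?_
    simp
  have := mul_le_mul_of_nonneg_left this (by positivity : (0 : ℝ) ≤ N * L)
  linarith

/-- The measure on `ℝ³` with density `ρ`. -/
noncomputable def densityMeasure (ρ : Space → ℝ) : Measure Space :=
  volume.withDensity fun x => ENNReal.ofReal (ρ x)

/-! ### Integration against the bounded density -/

section Density

variable {M : ℝ} {ρ : Space → ℝ}

theorem IsBoundedDensity.isFiniteMeasure (hρ : IsBoundedDensity M ρ) :
    IsFiniteMeasure (densityMeasure ρ) :=
  isFiniteMeasure_withDensity_ofReal hρ.integrable.2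

theorem IsBoundedDensity.integral_densityMeasure (hρ : IsBoundedDensity M ρ) (f : Space → ℝ) :
    ∫ x, f x ∂densityMeasure ρ = ∫ x, f x * ρ x := by
  rw [densityMeasure, integral_withDensity_eq_integral_toReal_smul₀
    hρ.integrable.aemeasurable.ennreal_ofReal (by simp)]
  refine integral_congr_ae ?_
  filter_upwards [hρ.nonneg] with x hx
  rw [ENNReal.toReal_ofReal hx, smul_eq_mul, mul_comm]

theorem IsBoundedDensity.integral_prod_densityMeasure (hρ : IsBoundedDensity M ρ)
    {f : Space × Space → ℝ} (hf : Measurable f) {B : ℝ} (hB : ∀ p, |f p| ≤ B)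
    {σ : Space → ℝ} (hσ : Integrable σ) :
    ∫ p : Space × Space, f p * (σ p.1 * ρ p.2) =
      ∫ x, (∫ y, f (x, y) ∂densityMeasure ρ) * σ x := by
  have h : Integrable (fun p : Space × Space => f p * (σ p.1 * ρ p.2)) (volume.prod volume) :=
    (hσ.mul_prod hρ.integrable).bdd_mul hf.aestronglyMeasurable (.of_forall hB)
  rw [Measure.volume_eq_prod, integral_prod _ h]
  refine integral_congr_ae (.of_forall fun x => ?_)
  simp only [hρ.integral_densityMeasure]
  rw [← integral_mul_const]
  refine integral_congr_ae (.of_forall fun y => ?_)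
  ring

theorem IsBoundedDensity.measurable_integral (hρ : IsBoundedDensity M ρ)
    {f : Space × Space → ℝ} (hf : Measurable f) :
    Measurable fun x => ∫ y, f (x, y) ∂densityMeasure ρ := by
  have := hρ.isFiniteMeasure
  exact hf.stronglyMeasurable.integral_prod_right'.measurable

theorem IsBoundedDensity.abs_integral_le (hρ : IsBoundedDensity M ρ)
    {f : Space × Space → ℝ} {B : ℝ} (hB : ∀ p, |f p| ≤ B) (x : Space) :
    |∫ y, f (x, y) ∂densityMeasure ρ| ≤ B * (densityMeasure ρ).real Set.univ := by
  have := hρ.isFiniteMeasure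
  exact norm_integral_le_of_norm_le_const (f := fun y => f (x, y)) (.of_forall fun y => hB (x, y))

end Density

/-! ### The two-body fluctuation of a bosonic state -/

section Fluctuation

variable {N : ℕ} (hN : 2 ≤ N) {ψ : Config N → ℂ} {M : ℝ} {ρ : Space → ℝ}

theorem integrable_twoBodyFluctuation (hψ : IsBosonicState ψ) (hρ : IsBoundedDensity M ρ) :
    Integrable (fun p : Space × Space => twoBodyFluctuation hN ψ ρ p.1 p.2) := by
  have h1 := integrable_massDensity_one (one_le_two.trans hN) hψ.integrable_sq
  exact ((((integrable_massDensity_two hN hψ.integrable_sq).const_mul _).sub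
    (h1.mul_prod hρ.integrable)).sub (hρ.integrable.mul_prod h1)).add
    (hρ.integrable.mul_prod hρ.integrable)

theorem integral_mul_twoBodyFluctuation (hψ : IsBosonicState ψ) (hρ : IsBoundedDensity M ρ)
    {f : Space × Space → ℝ} (hf : Measurable f) {B : ℝ} (hB : ∀ p, |f p| ≤ B) :
    ∫ p : Space × Space, f p * twoBodyFluctuation hN ψ ρ p.1 p.2 =
      ((N : ℝ) - 1) / N *
          (∫ X, f (X (Fin.castLE hN 0), X (Fin.castLE hN 1)) * ‖ψ X‖ ^ 2)
        - (∫ X, (∫ y, f (X (Fin.castLE hN 0), y) ∂densityMeasure ρ) * ‖ψ X‖ ^ 2)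
        - (∫ X, (∫ y, f (y, X (Fin.castLE hN 0)) ∂densityMeasure ρ) * ‖ψ X‖ ^ 2)
        + ∫ p, f p ∂(densityMeasure ρ).prod (densityMeasure ρ) := by
  have hfin := hρ.isFiniteMeasure
  have h1 := integrable_massDensity_one (one_le_two.trans hN) hψ.integrable_sq
  have h2 := integrable_massDensity_two hN hψ.integrable_sq
  have hs : Measurable fun p : Space × Space => f p.swap := hf.comp measurable_swap
  have i1 : Integrable (fun p : Space × Space =>
      f p * (((N : ℝ) - 1) / N * massDensity hN ψ ![p.1, p.2])) :=
    (h2.const_mul _).bdd_mul hf.aestronglyMeasurable (.of_forall hB)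
  have i2 : Integrable (fun p : Space × Space =>
      f p * (massDensity (one_le_two.trans hN) ψ ![p.1] * ρ p.2)) :=
    (h1.mul_prod hρ.integrable).bdd_mul hf.aestronglyMeasurable (.of_forall hB)
  have i3 : Integrable (fun p : Space × Space =>
      f p * (ρ p.1 * massDensity (one_le_two.trans hN) ψ ![p.2])) :=
    (hρ.integrable.mul_prod h1).bdd_mul hf.aestronglyMeasurable (.of_forall hB)
  have i4 : Integrable (fun p : Space × Space => f p * (ρ p.1 * ρ p.2)) :=
    (hρ.integrable.mul_prod hρ.integrable).bdd_mul hf.aestronglyMeasurable (.of_forall hB)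
  have hsum : ∀ p : Space × Space, f p * twoBodyFluctuation hN ψ ρ p.1 p.2 =
      f p * (((N : ℝ) - 1) / N * massDensity hN ψ ![p.1, p.2])
      - f p * (massDensity (one_le_two.trans hN) ψ ![p.1] * ρ p.2)
      - f p * (ρ p.1 * massDensity (one_le_two.trans hN) ψ ![p.2])
      + f p * (ρ p.1 * ρ p.2) := fun p => by
    rw [twoBodyFluctuation]
    ring
  have e1 : ∫ p : Space × Space, f p * (((N : ℝ) - 1) / N * massDensity hN ψ ![p.1, p.2]) =
      ((N : ℝ) - 1) / N *
        ∫ X, f (X (Fin.castLE hN 0), X (Fin.castLE hN 1)) * ‖ψ X‖ ^ 2 := by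
    rw [← integral_mul_massDensity_two hN hψ.integrable_sq hf hB, ← integral_const_mul]
    refine integral_congr_ae (.of_forall fun p => ?_)
    ring
  have marg : ∀ {f' : Space × Space → ℝ}, Measurable f' → (∀ p, |f' p| ≤ B) →
      ∫ p : Space × Space, f' p * (massDensity (one_le_two.trans hN) ψ ![p.1] * ρ p.2) =
        ∫ X, (∫ y, f' (X (Fin.castLE hN 0), y) ∂densityMeasure ρ) * ‖ψ X‖ ^ 2 := by
    intro f' hf' hB'
    rw [hρ.integral_prod_densityMeasure hf' hB' h1,
      integral_mul_massDensity_one (one_le_two.trans hN) hψ.integrable_sq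
        (hρ.measurable_integral hf') (hρ.abs_integral_le hB')]
    rfl
  have e3 : ∫ p : Space × Space, f p * (ρ p.1 * massDensity (one_le_two.trans hN) ψ ![p.2]) =
      ∫ X, (∫ y, f (y, X (Fin.castLE hN 0)) ∂densityMeasure ρ) * ‖ψ X‖ ^ 2 := by
    refine Eq.trans ?_ (marg hs fun p => hB p.swap)
    rw [Measure.volume_eq_prod, ← integral_prod_swap]
    refine integral_congr_ae (.of_forall fun p => ?_)
    simp only [Prod.swap]
    ring
  have e4 : ∫ p : Space × Space, f p * (ρ p.1 * ρ p.2) =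
      ∫ p, f p ∂(densityMeasure ρ).prod (densityMeasure ρ) := by
    rw [hρ.integral_prod_densityMeasure hf hB hρ.integrable,
      integral_prod _ (integrable_of_measurable_of_bdd hf hB), hρ.integral_densityMeasure]
  simp only [hsum]
  rw [integral_add ((i1.sub' i2).sub' i3) i4, integral_sub (i1.sub' i2) i3, integral_sub i1 i2, e1,
    marg hf hB, e3, e4]

/-- Permutations act transitively on ordered pairs of distinct particles. -/
theorem IsBosonicState.integral_pair {ψ : Config N → ℂ} (hψ : IsBosonicState ψ)
    (f : Space × Space → ℝ) {i j : Fin N} (hij : i ≠ j) :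
    ∫ X, f (X i, X j) * ‖ψ X‖ ^ 2 =
      ∫ X, f (X (Fin.castLE hN 0), X (Fin.castLE hN 1)) * ‖ψ X‖ ^ 2 := by
  have hinj : Function.Injective ![i, j] := by
    intro a b hab
    fin_cases a <;> fin_cases b <;> simp_all [eq_comm]
  obtain ⟨σ, hσ⟩ := Equiv.Perm.exists_extending_pair ![i, j] (Fin.castLE hN) hinj
    (Fin.castLE_injective hN)
  have h0 : σ i = Fin.castLE hN 0 := hσ 0
  have h1 : σ j = Fin.castLE hN 1 := hσ 1
  have := hψ.integral_comp_perm σ (fun X => f (X i, X j))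
  simp only [h0, h1] at this
  exact this.symm

theorem IsBosonicState.integral_single {ψ : Config N → ℂ} (hψ : IsBosonicState ψ)
    (f : Space → ℝ) (i j : Fin N) :
    ∫ X, f (X i) * ‖ψ X‖ ^ 2 = ∫ X, f (X j) * ‖ψ X‖ ^ 2 := by
  have := hψ.integral_comp_perm (Equiv.swap i j) (fun X => f (X i))
  simpa using this.symm

/-- Exchanging `x` and `y` permutes the two cross terms, and bosonic symmetry handles the pair term.
-/
theorem integral_swap_mul_twoBodyFluctuation (hψ : IsBosonicState ψ)
    (hρ : IsBoundedDensity M ρ) {f : Space × Space → ℝ} (hf : Measurable f) {B : ℝ}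
    (hB : ∀ p, |f p| ≤ B) :
    ∫ p : Space × Space, f p.swap * twoBodyFluctuation hN ψ ρ p.1 p.2 =
      ∫ p : Space × Space, f p * twoBodyFluctuation hN ψ ρ p.1 p.2 := by
  have hfin := hρ.isFiniteMeasure
  have h01 : Fin.castLE hN 1 ≠ Fin.castLE hN 0 := by
    simp [Fin.ext_iff]
  rw [integral_mul_twoBodyFluctuation hN hψ hρ (f := fun p => f p.swap) (hf.comp measurable_swap)
    (fun p => hB p.swap), integral_mul_twoBodyFluctuation hN hψ hρ hf hB, integral_prod_swap]
  simp only [Prod.swap]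
  rw [hψ.integral_pair hN f h01]
  ring

theorem IsConvSquare.even {g : Space → ℝ} (hg : IsConvSquare g) (x y : Space) :
    g (x - y) = g (y - x) := by
  obtain ⟨h, -, -, -, hfac⟩ := hg.factor
  rw [hfac, hfac]
  simp only [mul_comm]

theorem IsConvSquare.weightedKernel_swap {g : Space → ℝ} (hg : IsConvSquare g) (W : Space → ℝ)
    (p : Space × Space) : weightedKernel W g p.swap = weightedKernel W g p := by
  rw [weightedKernel, weightedKernel, Prod.fst_swap, Prod.snd_swap, hg.even, add_comm]

theorem IsConvSquare.integral_weightedKernel_mul_twoBodyFluctuation {g : Space → ℝ}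
    (hg : IsConvSquare g) (hψ : IsBosonicState ψ) (hρ : IsBoundedDensity M ρ) {W : Space → ℝ}
    (hW : Measurable W) {b : ℝ} (hW0 : ∀ x, 0 ≤ W x) (hWb : ∀ x, W x ≤ b) :
    ∫ p : Space × Space, weightedKernel W g p * twoBodyFluctuation hN ψ ρ p.1 p.2 =
      ∫ p : Space × Space, W p.1 * g (p.1 - p.2) * twoBodyFluctuation hN ψ ρ p.1 p.2 := by
  obtain ⟨Bg, hBg⟩ := hg.bdd
  have hgm := hg.continuous.measurable
  let f : Space × Space → ℝ := fun p => W p.1 * g (p.1 - p.2)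
  have hf : Measurable f := by fun_prop
  have hB : ∀ p, |f p| ≤ b * Bg := fun p => by
    rw [abs_of_nonneg (mul_nonneg (hW0 _) (hg.nonneg _))]
    exact mul_le_mul (hWb _) (hBg _) (hg.nonneg _) ((hW0 p.1).trans (hWb _))
  have hi := integrable_twoBodyFluctuation hN hψ hρ
  have i1 : Integrable (fun p : Space × Space => f p * twoBodyFluctuation hN ψ ρ p.1 p.2) :=
    hi.bdd_mul hf.aestronglyMeasurable (.of_forall hB)
  have i2 : Integrable (fun p : Space × Space => f p.swap * twoBodyFluctuation hN ψ ρ p.1 p.2) :=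
    hi.bdd_mul (hf.comp measurable_swap).aestronglyMeasurable (.of_forall fun p => hB p.swap)
  have hsplit : ∀ p : Space × Space,
      weightedKernel W g p * twoBodyFluctuation hN ψ ρ p.1 p.2 =
        1 / 2 * (f p * twoBodyFluctuation hN ψ ρ p.1 p.2 +
          f p.swap * twoBodyFluctuation hN ψ ρ p.1 p.2) := fun p => by
    simp only [f, weightedKernel, Prod.fst_swap, Prod.snd_swap, hg.even p.2 p.1]
    ring
  simp only [hsplit]
  rw [integral_const_mul, integral_add i1 i2,
    integral_swap_mul_twoBodyFluctuation hN hψ hρ hf hB]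
  ring

/-- The empirical bound is averaged over `|ψ|²` and divided by `N²`. Of the `N²` pairs, the `N(N-1)`
off-diagonal ones all have the same mean, which produces the factor `(N-1)/N`; the `N` diagonal ones
contribute at most `b * g 0 / N`. -/
theorem IsConvSquare.weighted_fluctuation_lower_bound {g : Space → ℝ}
    (hg : IsConvSquare g) (hψ : IsBosonicState ψ) (hρ : IsBoundedDensity M ρ) {W : Space → ℝ}
    {L : ℝ≥0} (hWL : LipschitzWith L W) {b : ℝ} (hW0 : ∀ x, 0 ≤ W x) (hWb : ∀ x, W x ≤ b)
    {m : ℝ} (hm : ∀ x, ∫ y, ‖x - y‖ * g (x - y) ∂densityMeasure ρ ≤ m) :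
    -(L * m + b * g 0 / N) ≤
      ∫ p : Space × Space, W p.1 * g (p.1 - p.2) * twoBodyFluctuation hN ψ ρ p.1 p.2 := by
  have hfin := hρ.isFiniteMeasure
  have hWm := hWL.continuous.measurable
  have hgm := hg.continuous.measurable
  have hSm := measurable_weightedKernel hWm hgm
  have hD := hψ.integrable_sq
  obtain ⟨B, hB⟩ := hg.exists_weightedKernel_bdd hW0 hWb
  rw [← hg.integral_weightedKernel_mul_twoBodyFluctuation hN hψ hρ hWm hW0 hWb,
    integral_mul_twoBodyFluctuation hN hψ hρ hSm hB]
  have hsw : ∀ x y, weightedKernel W g (x, y) = weightedKernel W g (y, x) := fun x y =>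
    hg.weightedKernel_swap W (y, x)
  simp only [fun (X : Config N) (y : Space) => hsw y (X (Fin.castLE hN 0))]
  set i₀ : Fin N := Fin.castLE hN 0
  set E₂ := ∫ X, weightedKernel W g (X i₀, X (Fin.castLE hN 1)) * ‖ψ X‖ ^ 2
  set E₁ := ∫ X, (∫ y, weightedKernel W g (X i₀, y) ∂densityMeasure ρ) * ‖ψ X‖ ^ 2 with hE₁
  set c := ∫ p, weightedKernel W g p ∂(densityMeasure ρ).prod (densityMeasure ρ)
  have iS : ∀ i j : Fin N,
      Integrable (fun X : Config N => weightedKernel W g (X i, X j) * ‖ψ X‖ ^ 2) := fun i j =>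
    hD.bdd_mul (hSm.comp (by fun_prop)).aestronglyMeasurable (.of_forall fun X => hB _)
  have iT : ∀ i : Fin N, Integrable (fun X : Config N =>
      (∫ y, weightedKernel W g (X i, y) ∂densityMeasure ρ) * ‖ψ X‖ ^ 2) := fun i =>
    hD.bdd_mul ((hρ.measurable_integral hSm).comp (measurable_pi_apply i)).aestronglyMeasurable
      (.of_forall fun X => hρ.abs_integral_le hB (X i))
  have diag : ∀ i, ∫ X, weightedKernel W g (X i, X i) * ‖ψ X‖ ^ 2 ≤ b * g 0 := fun i => by
    calc ∫ X, weightedKernel W g (X i, X i) * ‖ψ X‖ ^ 2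
        ≤ ∫ X, b * g 0 * ‖ψ X‖ ^ 2 := by
          refine integral_mono (iS i i) (hD.const_mul _) fun X => ?_
          refine mul_le_mul_of_nonneg_right ?_ (by positivity)
          simp only [weightedKernel, sub_self, add_self_div_two]
          exact mul_le_mul_of_nonneg_right (hWb _) (hg.nonneg _)
      _ = b * g 0 := by rw [integral_const_mul, hψ.normalized, mul_one]
  have row : ∀ i, ∑ j, ∫ X, weightedKernel W g (X i, X j) * ‖ψ X‖ ^ 2 ≤
      b * g 0 + (N - 1) * E₂ := fun i => by
    rw [← Finset.add_sum_erase _ _ (Finset.mem_univ i)]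
    have : ∑ j ∈ Finset.univ.erase i, ∫ X, weightedKernel W g (X i, X j) * ‖ψ X‖ ^ 2 =
        (N - 1) * E₂ := by
      rw [Finset.sum_congr rfl fun j hj =>
        hψ.integral_pair hN (weightedKernel W g) (Finset.ne_of_mem_erase hj).symm]
      rw [Finset.sum_const, Finset.card_erase_of_mem (Finset.mem_univ i), Finset.card_univ,
        Fintype.card_fin, nsmul_eq_mul, Nat.cast_sub (by omega), Nat.cast_one]
    rw [this]
    linarith [diag i]
  have key : -(L * m * N ^ 2) ≤
      (∑ i, ∑ j, ∫ X, weightedKernel W g (X i, X j) * ‖ψ X‖ ^ 2) -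
        2 * N * (∑ i : Fin N, ∫ X : Config N,
          (∫ y, weightedKernel W g (X i, y) ∂densityMeasure ρ) * ‖ψ X‖ ^ 2) + N ^ 2 * c := by
    -- Terms independent of `X` are gathered on the left, where normalization of `ψ` integrates
    -- them.
    have h1 : ∫ X, (-(L * m * N ^ 2) - N ^ 2 * c) * ‖ψ X‖ ^ 2 ≤
        ∫ X : Config N, ((∑ i, ∑ j, weightedKernel W g (X i, X j) * ‖ψ X‖ ^ 2) -
          2 * N * ∑ i, (∫ y, weightedKernel W g (X i, y) ∂densityMeasure ρ) * ‖ψ X‖ ^ 2) := by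
      refine integral_mono (hD.const_mul _) ((integrable_finsetSum _ fun i _ =>
        integrable_finsetSum _ fun j _ => iS i j).sub
        ((integrable_finsetSum _ fun i _ => iT i).const_mul _)) fun X => ?_
      have h2 := hg.empirical_energy_lower_bound hWL hW0 hWb (densityMeasure ρ) X hm
      simp only [← Finset.sum_mul]
      rw [← mul_assoc, ← sub_mul]
      exact mul_le_mul_of_nonneg_right (by linarith) (by positivity)
    rw [integral_const_mul, hψ.normalized, mul_one, integral_sub (integrable_finsetSum _ fun i _ =>
        integrable_finsetSum _ fun j _ => iS i j)
        ((integrable_finsetSum _ fun i _ => iT i).const_mul _), integral_const_mul,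
        integral_finsetSum _ (fun i _ => integrable_finsetSum _ fun j _ => iS i j),
        integral_finsetSum _ (fun i _ => iT i)] at h1
    simp only [fun i => integral_finsetSum Finset.univ (fun j _ => iS i j)] at h1
    linarith
  have hT : ∑ i : Fin N, ∫ X : Config N,
      (∫ y, weightedKernel W g (X i, y) ∂densityMeasure ρ) * ‖ψ X‖ ^ 2 = N * E₁ := by
    rw [Finset.sum_congr rfl fun i _ => hψ.integral_single
      (fun x => ∫ y, weightedKernel W g (x, y) ∂densityMeasure ρ) i i₀]
    simp [hE₁]
  have hS : ∑ i, ∑ j, ∫ X, weightedKernel W g (X i, X j) * ‖ψ X‖ ^ 2 ≤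
      N * (b * g 0 + (N - 1) * E₂) := by
    refine (Finset.sum_le_sum fun i _ => row i).trans_eq ?_
    simp [mul_add]
  rw [hT] at key
  have hN0 : (0 : ℝ) < N := by
    have : 0 < N := by omega
    exact_mod_cast this
  have h3 : -(L * m * N ^ 2) ≤
      N * (b * g 0 + (N - 1) * E₂) - 2 * N * (N * E₁) + N ^ 2 * c := by linarith
  have h4 : N * (b * g 0 + (N - 1) * E₂) - 2 * N * (N * E₁) + N ^ 2 * c + L * m * N ^ 2 =
      N ^ 2 * ((((N : ℝ) - 1) / N * E₂ - E₁ - E₁ + c) + (L * m + b * g 0 / N)) := by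
    field_simp
    ring
  have h5 : 0 ≤ (((N : ℝ) - 1) / N * E₂ - E₁ - E₁ + c) + (L * m + b * g 0 / N) := by
    refine nonneg_of_mul_nonneg_right (a := (N : ℝ) ^ 2) ?_ (by positivity)
    rw [← h4]
    linarith
  linarith

end Fluctuation

/-! ### Gaussian profiles and their scaling -/

theorem integrable_exp_neg_mul_norm_sq {b : ℝ} (hb : 0 < b) :
    Integrable fun x : Space => Real.exp (-b * ‖x‖ ^ 2) := by
  -- A nonzero Bochner integral forces integrability.
  refine not_imp_comm.1 integral_undef ?_
  rw [GaussianFourier.integral_rexp_neg_mul_sq_norm hb]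
  positivity

theorem mul_exp_neg_mul_sq_le {b : ℝ} (hb : 0 < b) (t : ℝ) :
    t * Real.exp (-b * t ^ 2) ≤ 1 / √b := by
  have hs := Real.sqrt_pos.2 hb
  have h1 : √b * t ≤ Real.exp (b * t ^ 2) := by
    have h2 := Real.add_one_le_exp (b * t ^ 2)
    have h3 : b * t ^ 2 = (√b * t) ^ 2 := by rw [mul_pow, Real.sq_sqrt hb.le]
    nlinarith [sq_nonneg (√b * t - 1)]
  rw [neg_mul, Real.exp_neg, ← div_eq_mul_inv, div_le_div_iff₀ (Real.exp_pos _) hs]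
  linarith

theorem integrable_norm_mul_exp_neg_mul_norm_sq {b : ℝ} (hb : 0 < b) :
    Integrable fun x : Space => ‖x‖ * Real.exp (-b * ‖x‖ ^ 2) := by
  have h := (integrable_exp_neg_mul_norm_sq (half_pos hb)).bdd_mul
    (f := fun x : Space => ‖x‖ * Real.exp (-(b / 2) * ‖x‖ ^ 2)) (c := 1 / √(b / 2))
    (by fun_prop) (.of_forall fun x => by
      rw [Real.norm_of_nonneg (by positivity)]
      exact mul_exp_neg_mul_sq_le (half_pos hb) _)
  refine h.congr (.of_forall fun x => ?_)
  simp only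
  rw [mul_assoc, ← Real.exp_add]
  ring_nf

/-- The factor is a Gaussian of rate `2b`: the parallelogram law completes the square at the
midpoint of `x` and `y`, leaving rate `b` in `x - y` and `4b` in `z`. The constant `√(a / I)`
normalizes the remaining integral. -/
theorem isConvSquare_gaussian {a b : ℝ} (ha : 0 ≤ a) (hb : 0 < b) :
    IsConvSquare fun x => a * Real.exp (-b * ‖x‖ ^ 2) where
  continuous := by fun_prop
  nonneg x := by positivity
  bdd := ⟨a, fun x => mul_le_of_le_one_right ha (Real.exp_le_one_iff.2 (by
    have : 0 ≤ b * ‖x‖ ^ 2 := by positivity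
    linarith))⟩
  bdd_moment := ⟨a * (1 / √b), fun x => by
    rw [mul_left_comm]
    exact mul_le_mul_of_nonneg_left (mul_exp_neg_mul_sq_le hb _) ha⟩
  factor := by
    set I := ∫ z : Space, Real.exp (-(4 * b) * ‖z‖ ^ 2) with hI
    have hIpos : 0 < I := by
      rw [hI, GaussianFourier.integral_rexp_neg_mul_sq_norm (by positivity)]
      positivity
    refine ⟨fun x => √(a / I) * Real.exp (-(2 * b) * ‖x‖ ^ 2), by fun_prop,
      (integrable_exp_neg_mul_norm_sq (by positivity)).const_mul _, ⟨√(a / I), fun x => ?_⟩,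
      fun x y => ?_⟩
    · rw [abs_of_nonneg (by positivity)]
      refine mul_le_of_le_one_right (Real.sqrt_nonneg _) (Real.exp_le_one_iff.2 ?_)
      have : 0 ≤ 2 * b * ‖x‖ ^ 2 := by positivity
      linarith
    · have hz : ∀ z : Space, √(a / I) * Real.exp (-(2 * b) * ‖x - z‖ ^ 2) *
          (√(a / I) * Real.exp (-(2 * b) * ‖y - z‖ ^ 2)) =
          a / I * Real.exp (-b * ‖x - y‖ ^ 2) *
            Real.exp (-(4 * b) * ‖z - (2⁻¹ : ℝ) • (x + y)‖ ^ 2) := fun z => by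
        have h1 := parallelogram_law_with_norm ℝ (x - z) (y - z)
        have h2 : x - z + (y - z) = (-2 : ℝ) • (z - (2⁻¹ : ℝ) • (x + y)) := by
          module
        rw [h2, norm_smul, sub_sub_sub_cancel_right] at h1
        norm_num at h1
        have h3 : -(2 * b) * ‖x - z‖ ^ 2 + -(2 * b) * ‖y - z‖ ^ 2 =
            -b * ‖x - y‖ ^ 2 + -(4 * b) * ‖z - (2⁻¹ : ℝ) • (x + y)‖ ^ 2 := by
          norm_num
          linear_combination b * h1
        rw [mul_mul_mul_comm, Real.mul_self_sqrt (by positivity), mul_assoc (a / I),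
          ← Real.exp_add, ← Real.exp_add, h3]
      simp only [hz]
      rw [integral_const_mul,
        integral_sub_right_eq_self (fun z : Space => Real.exp (-(4 * b) * ‖z‖ ^ 2)), ← hI]
      field_simp

theorem scaledGaussian_eq (η : ℝ) (N : ℕ) (x : Space) :
    scaledGaussian η N x = (N : ℝ) ^ (3 * η) * (1 / Real.pi) ^ (3 / 2 : ℝ) *
      Real.exp (-((N : ℝ) ^ η) ^ 2 * ‖x‖ ^ 2) := by
  rw [scaledGaussian, gaussian, norm_smul, mul_pow, Real.norm_eq_abs, sq_abs, neg_mul, mul_assoc]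

theorem isConvSquare_scaledGaussian (η : ℝ) {N : ℕ} (hN : 0 < N) :
    IsConvSquare (scaledGaussian η N) := by
  have h0 : (0 : ℝ) < N := by exact_mod_cast hN
  rw [funext (scaledGaussian_eq η N)]
  exact isConvSquare_gaussian (by positivity) (by positivity)

theorem scaledGaussian_zero (η : ℝ) (N : ℕ) :
    scaledGaussian η N 0 = (N : ℝ) ^ (3 * η) * (1 / Real.pi) ^ (3 / 2 : ℝ) := by
  simp [scaledGaussian, gaussian]

theorem integrable_norm_mul_scaledGaussian (η : ℝ) {N : ℕ} (hN : 0 < N) :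
    Integrable fun x : Space => ‖x‖ * scaledGaussian η N x := by
  have h0 : (0 : ℝ) < N := by exact_mod_cast hN
  refine ((integrable_norm_mul_exp_neg_mul_norm_sq (b := ((N : ℝ) ^ η) ^ 2)
    (by positivity)).const_mul ((N : ℝ) ^ (3 * η) * (1 / Real.pi) ^ (3 / 2 : ℝ))).congr
    (.of_forall fun x => ?_)
  simp only
  rw [scaledGaussian_eq]
  ring

theorem integral_norm_mul_scaledGaussian (η : ℝ) {N : ℕ} (hN : 0 < N) :
    ∫ x : Space, ‖x‖ * scaledGaussian η N x =
      (N : ℝ) ^ (-η) * ∫ x : Space, ‖x‖ * gaussian x := by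
  have h0 : (0 : ℝ) < N := by exact_mod_cast hN
  have hl : (0 : ℝ) < (N : ℝ) ^ η := by positivity
  have h3 : (N : ℝ) ^ (3 * η) = ((N : ℝ) ^ η) ^ 3 := by
    rw [mul_comm, Real.rpow_mul h0.le]
    norm_cast
  -- With `λ = N^η`, the prefactor `λ²` meets the Jacobian `λ⁻³`, leaving `λ⁻¹`.
  have h : ∀ x : Space, ‖x‖ * scaledGaussian η N x =
      ((N : ℝ) ^ η) ^ 2 * (‖(N : ℝ) ^ η • x‖ * gaussian ((N : ℝ) ^ η • x)) := fun x => by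
    rw [scaledGaussian, h3, norm_smul, Real.norm_of_nonneg hl.le]
    ring
  simp only [h]
  rw [integral_const_mul,
    Measure.integral_comp_smul volume (fun x : Space => ‖x‖ * gaussian x) ((N : ℝ) ^ η),
    finrank_euclideanSpace_fin, abs_of_nonneg (by positivity), smul_eq_mul, Real.rpow_neg h0.le]
  field_simp

theorem IsBoundedDensity.integral_norm_mul_scaledGaussian_le {M : ℝ} {ρ : Space → ℝ}
    (hρ : IsBoundedDensity M ρ) (η : ℝ) {N : ℕ} (hN : 0 < N) (x : Space) :
    ∫ y, ‖x - y‖ * scaledGaussian η N (x - y) ∂densityMeasure ρ ≤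
      |M| * ((N : ℝ) ^ (-η) * ∫ x : Space, ‖x‖ * gaussian x) := by
  have hg := isConvSquare_scaledGaussian η hN
  rw [hρ.integral_densityMeasure, ← integral_norm_mul_scaledGaussian η hN,
    ← integral_sub_left_eq_self (fun y => ‖y‖ * scaledGaussian η N y) volume x,
    ← integral_const_mul]
  refine integral_mono_of_nonneg ?_
    (((integrable_norm_mul_scaledGaussian η hN).comp_sub_left x).const_mul _) ?_
  · filter_upwards [hρ.nonneg] with y hy
    exact mul_nonneg (mul_nonneg (norm_nonneg _) (hg.nonneg _)) hy
  · filter_upwards [hρ.le_bound] with y hy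
    rw [mul_comm]
    exact mul_le_mul_of_nonneg_right (hy.trans (le_abs_self M))
      (mul_nonneg (norm_nonneg _) (hg.nonneg _))

end QuantumNBody

theorem lemma4p4 (η : ℝ) (hη : η < 1 / 3) (M K : ℝ) (L : ℝ≥0) :
    ∃ C : ℝ, 0 ≤ C ∧
      ∀ (N : ℕ) (hN : 2 ≤ N) (ℏ : ℝ), 0 < ℏ → ℏ ≤ 1 →
      ∀ ψ : Config N → ℂ, IsBosonicState ψ →
      ∀ ρ : Space → ℝ, IsBoundedDensity M ρ →
      ∀ F : Space → ℝ, (∀ x, |F x| ≤ K) → LipschitzWith L F →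
        Integrable (fun p : Space × Space =>
          F p.1 * scaledGaussian η N (p.1 - p.2) * twoBodyFluctuation hN ψ ρ p.1 p.2) ∧
        Integrable (fun p : Space × Space =>
          scaledGaussian η N (p.1 - p.2) * twoBodyFluctuation hN ψ ρ p.1 p.2) ∧
        (∫ p : Space × Space,
            F p.1 * scaledGaussian η N (p.1 - p.2) * twoBodyFluctuation hN ψ ρ p.1 p.2)
          ≤ (⨆ x, |F x|) *
              (∫ p : Space × Space,
                scaledGaussian η N (p.1 - p.2) * twoBodyFluctuation hN ψ ρ p.1 p.2)
            + C * ((N : ℝ) ^ (-η) * ℏ ^ (-2 : ℤ) + (N : ℝ) ^ (3 * η - 1)) := by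
  set m₁ : ℝ := ∫ x : Space, ‖x‖ * gaussian x with hm₁
  have hm₁0 : 0 ≤ m₁ := integral_nonneg fun x => by
    rw [gaussian]
    positivity
  -- `c₁` pays for the cross term, `c₂` for the diagonal, where `W ≤ 2|K|`. Absolute values keep
  -- both nonnegative whatever the signs of `M` and `K`.
  set c₁ : ℝ := L * (|M| * m₁) with hc₁
  set c₂ : ℝ := 2 * |K| * (1 / Real.pi) ^ (3 / 2 : ℝ) with hc₂
  have hc₁0 : 0 ≤ c₁ := by positivity
  have hc₂0 : 0 ≤ c₂ := by positivity
  refine ⟨c₁ + c₂, by positivity, ?_⟩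
  intro N hN ℏ hℏ hℏ1 ψ hψ ρ hρ F hFK hFL
  have hNpos : 0 < N := by omega
  have hN0 : (0 : ℝ) < N := by exact_mod_cast hNpos
  have hg := isConvSquare_scaledGaussian η hNpos
  obtain ⟨Bg, hBg⟩ := hg.bdd
  have hFm : Measurable F := hFL.continuous.measurable
  have hgm : Measurable (scaledGaussian η N) := hg.continuous.measurable
  have hi := integrable_twoBodyFluctuation hN hψ hρ
  have i1 : Integrable (fun p : Space × Space =>
      scaledGaussian η N (p.1 - p.2) * twoBodyFluctuation hN ψ ρ p.1 p.2) :=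
    hi.bdd_mul (c := Bg) (hgm.comp (by fun_prop)).aestronglyMeasurable (.of_forall fun p => by
      rw [Real.norm_of_nonneg (hg.nonneg _)]
      exact hBg _)
  have i2 : Integrable (fun p : Space × Space =>
      F p.1 * scaledGaussian η N (p.1 - p.2) * twoBodyFluctuation hN ψ ρ p.1 p.2) := by
    simp only [mul_assoc]
    exact i1.bdd_mul (hFm.comp measurable_fst).aestronglyMeasurable (.of_forall fun p => hFK p.1)
  refine ⟨i2, i1, ?_⟩
  have hbdd : BddAbove (Set.range fun x => |F x|) := ⟨K, by
    rintro _ ⟨x, rfl⟩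
    exact hFK x⟩
  set S : ℝ := ⨆ x, |F x| with hS
  have hFS : ∀ x, |F x| ≤ S := fun x => le_ciSup hbdd x
  have hSK : S ≤ |K| := ciSup_le fun x => (hFK x).trans (le_abs_self K)
  have hWL : LipschitzWith L fun x => S - F x := LipschitzWith.of_dist_le_mul fun x y => by
    rw [dist_sub_left]
    exact hFL.dist_le_mul x y
  have hb := hg.weighted_fluctuation_lower_bound hN hψ hρ hWL (b := 2 * |K|)
    (fun x => sub_nonneg.2 ((le_abs_self _).trans (hFS x)))
    (fun x => by linarith [neg_abs_le (F x), hFS x])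
    (hρ.integral_norm_mul_scaledGaussian_le η hNpos)
  have hsplit : ∀ p : Space × Space,
      (S - F p.1) * scaledGaussian η N (p.1 - p.2) * twoBodyFluctuation hN ψ ρ p.1 p.2 =
        S * (scaledGaussian η N (p.1 - p.2) * twoBodyFluctuation hN ψ ρ p.1 p.2) -
          F p.1 * scaledGaussian η N (p.1 - p.2) * twoBodyFluctuation hN ψ ρ p.1 p.2 :=
    fun p => by ring
  simp only [hsplit] at hb
  rw [integral_sub (i1.const_mul S) i2, integral_const_mul, scaledGaussian_zero] at hb
  have e1 : L * (|M| * ((N : ℝ) ^ (-η) * ∫ x : Space, ‖x‖ * gaussian x)) =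
      c₁ * (N : ℝ) ^ (-η) := by
    rw [hc₁, hm₁]
    ring
  have e2 : 2 * |K| * ((N : ℝ) ^ (3 * η) * (1 / Real.pi) ^ (3 / 2 : ℝ)) / N =
      c₂ * (N : ℝ) ^ (3 * η - 1) := by
    rw [hc₂, Real.rpow_sub_one hN0.ne']
    ring
  rw [e1, e2] at hb
  -- The bound obtained so far has no `ℏ`; since `ℏ ≤ 1`, inserting `ℏ⁻²` only weakens it.
  have hz : 1 ≤ ℏ ^ (-2 : ℤ) := by
    rw [zpow_neg]
    exact (one_le_inv₀ (by positivity)).2 (by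
      norm_cast
      exact pow_le_one₀ hℏ.le hℏ1)
  have h1 : (N : ℝ) ^ (-η) ≤ (N : ℝ) ^ (-η) * ℏ ^ (-2 : ℤ) :=
    le_mul_of_one_le_right (by positivity) hz
  have h2 : 0 ≤ (N : ℝ) ^ (3 * η - 1) := by positivity
  have h3 := mul_le_mul_of_nonneg_left h1 hc₁0
  have h4 := mul_nonneg hc₁0 h2
  have h5 : 0 ≤ c₂ * ((N : ℝ) ^ (-η) * ℏ ^ (-2 : ℤ)) := by positivity
  linarith
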